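/- All graphs are finite, undirected and simple. A graph $H$ is a minor of a graph $G$ if $H$ is isomorphic to a graph obtained from a subgraph of $G$ by contracting edges (discarding loops and parallel edges). Let $\mathcal{K}_9^{-6}$ denote the family of all graphs obtained from the complete graph $K_9$ by deleting exactly six edges; $G$ has a $\mathcal{K}_9^{-6}$ minor if some $H\in\mathcal{K}_9^{-6}$ is a minor of $G$. A $6$-clique is a set of six pairwise adjacent vertices, and $G$ is $7$-connected if it has more than seven vertices and deleting any set of fewer than seven vertices leaves a connected graph. Let $G$ be a $7$-connected graph with at least $19$ vertices, and let $L_1,L_2,L_3$ be $6$-cliques of $G$ such that $$\min\{|L_1\setminus(L_2\cup L_3)|,\ |L_2\setminus(L_1\cup L_3)|,\ |L_3\setminus(L_1\cup L_2)|\}\ge 1.$$ Then $G$ has a $\mathcal{K}_9^{-6}$ minor. -/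

import Mathlib

namespace SimpleGraph

/-- A finite graph is `k`-connected if it has more than `k` vertices and
deleting any set of fewer than `k` vertices leaves a connected graph. -/
def IsKConnected {V : Type*} [Fintype V] (G : SimpleGraph V) (k : ℕ) : Prop :=
  k < Fintype.card V ∧
    ∀ S : Finset V, S.card < k → (G.induce ((S : Set V)ᶜ)).Connected

/-- The simple graph obtained from `K` by contracting all the edges in `F`: its vertices are the
connected components of the spanning subgraph of `K` with edge set `F`, and two
distinct components are adjacent when `K` has an edge between them (loops and parallel
edges are discarded). -/
def contractEdges {W : Type*} (K : SimpleGraph W) (F : Set (Sym2 W)) :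
    SimpleGraph (fromEdgeSet F).ConnectedComponent where
  Adj C D := C ≠ D ∧ ∃ x y : W, (fromEdgeSet F).connectedComponentMk x = C ∧
    (fromEdgeSet F).connectedComponentMk y = D ∧ K.Adj x y
  symm := ⟨fun _ _ ⟨hne, x, y, hx, hy, h⟩ => ⟨hne.symm, y, x, hy, hx, h.symm⟩⟩
  loopless := ⟨fun _ h => h.1 rfl⟩

/-- `H` is a minor of `G`: up to isomorphism, `H` is obtained from a subgraph of `G` by
contracting edges. -/
def IsMinorOf {U V : Type*} (H : SimpleGraph U) (G : SimpleGraph V) : Prop :=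
  ∃ (K : G.Subgraph) (F : Set (Sym2 K.verts)),
    F ⊆ K.coe.edgeSet ∧ Nonempty (H ≃g K.coe.contractEdges F)

/-- The family of graphs obtained from the complete graph on `t` vertices by deleting
exactly `s` edges. -/
def completeMinus (t s : ℕ) : Set (SimpleGraph (Fin t)) :=
  {H | ∃ D : Finset (Sym2 (Fin t)), (D : Set (Sym2 (Fin t))) ⊆ (completeGraph (Fin t)).edgeSet ∧
    D.card = s ∧ H = (completeGraph (Fin t)).deleteEdges D}

/-- `G` has a minor in the family of graphs obtained from the complete graph on `t` vertices by
deleting `s` edges. -/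
def HasCompleteMinusMinor {V : Type*} (G : SimpleGraph V) (t s : ℕ) : Prop :=
  ∃ H ∈ completeMinus t s, H.IsMinorOf G

end SimpleGraph

namespace SimpleGraph

/-! The size of the pairwise intersections decides. If 6-cliques `A`, `B` share at most three
vertices, Menger gives six disjoint connected links from `A` to `B`, at least three of them with
distinct ends. Splitting three such links into the end in `A` and a connected rest containing the
end in `B` gives nine branch sets. Only an `A`-end and the rest of a different split link can be
non-adjacent: 3 · 2 = 6 pairs (`hasCompleteMinusMinor_of_inter_le`).

If they share four vertices, `A ∪ B` has eight vertices and misses at most four edges. A component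
outside eight vertices serves as a ninth branch set; by 7-connectivity it is adjacent to all but at
most one of them (`hasCompleteMinusMinor_of_eight`).

Otherwise all three pairs share exactly five vertices. A private vertex of `L₃` then forces the
three intersections to coincide, so the union again has eight vertices, and misses at most three
edges. -/

theorem Connected.subset_of_closed {V : Type*} {G : SimpleGraph V} {s D : Set V}
    (hs : (G.induce s).Connected) {a : V} (has : a ∈ s) (haD : a ∈ D)
    (hD : ∀ u ∈ s, u ∈ D → ∀ v ∈ s, G.Adj u v → v ∈ D) : s ⊆ D := by
  intro b hb
  by_contra hbD
  obtain ⟨p⟩ := hs.preconnected ⟨a, has⟩ ⟨b, hb⟩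
  obtain ⟨d, -, h1, h2⟩ := p.exists_boundary_dart (Subtype.val ⁻¹' D) haD hbD
  exact h2 (hD _ d.fst.2 h1 _ d.snd.2 d.adj)

theorem Connected.induce_mono_graph {V : Type*} {G H : SimpleGraph V} {s : Set V}
    (hs : (G.induce s).Connected) (h : G ≤ H) : (H.induce s).Connected :=
  hs.mono fun _ _ hab => h hab

theorem connected_induce_singleton {V : Type*} (G : SimpleGraph V) (v : V) :
    (G.induce {v}).Connected := by
  have : Nonempty ({v} : Set V) := ⟨⟨v, rfl⟩⟩
  exact ⟨Preconnected.of_subsingleton⟩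

/-! ### Menger's theorem -/

/-- `P` and `Q` cover the graph, and no edge joins `P \ Q` to `Q \ P`. -/
structure IsSeparation {V : Type*} (G : SimpleGraph V) (P Q : Set V) : Prop where
  cover : ∀ v, v ∈ P ∨ v ∈ Q
  not_adj : ∀ u v, u ∈ P → u ∉ Q → v ∈ Q → v ∉ P → ¬ G.Adj u v

theorem IsSeparation.swap {V : Type*} {G : SimpleGraph V} {P Q : Set V}
    (h : G.IsSeparation P Q) : G.IsSeparation Q P :=
  ⟨fun v => (h.cover v).symm, fun u v hu hu' hv hv' huv => h.not_adj v u hv hv' hu hu' huv.symm⟩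

/-- Every separation of `A` from `B` has order at least `k`. -/
def SeparationsGE {V : Type*} (G : SimpleGraph V) (A B : Set V) (k : ℕ) : Prop :=
  ∀ P Q : Set V, G.IsSeparation P Q → A ⊆ P → B ⊆ Q → k ≤ (P ∩ Q).ncard

theorem SeparationsGE.swap {V : Type*} {G : SimpleGraph V} {A B : Set V} {k : ℕ}
    (h : G.SeparationsGE A B k) : G.SeparationsGE B A k := fun P Q hPQ hP hQ => by
  rw [Set.inter_comm]; exact h Q P hPQ.swap hQ hP

/-- There are `k` disjoint connected sets, each meeting both `A` and `B`. -/
def HasLinks {V : Type*} (G : SimpleGraph V) (A B : Set V) (k : ℕ) : Prop :=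
  ∃ f : Fin k → Set V, (∀ i j, i ≠ j → Disjoint (f i) (f j)) ∧
    ∀ i, (G.induce (f i)).Connected ∧ (f i ∩ A).Nonempty ∧ (f i ∩ B).Nonempty

theorem HasLinks.mono {V : Type*} {G H : SimpleGraph V} {A B : Set V} {k : ℕ}
    (h : G.HasLinks A B k) (hGH : G ≤ H) : H.HasLinks A B k := by
  obtain ⟨f, hd, hf⟩ := h
  exact ⟨f, hd, fun i => ⟨(hf i).1.induce_mono_graph hGH, (hf i).2⟩⟩

theorem deleteEdge_lt {V : Type*} {G H : SimpleGraph V} [Finite V] {x y : V} (hxy : G.Adj x y)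
    (hle : H ≤ G) (hH : ¬ H.Adj x y) : H.edgeSet.ncard < G.edgeSet.ncard := by
  refine Set.ncard_lt_ncard ⟨edgeSet_mono hle, fun h => ?_⟩ (Set.toFinite _)
  exact hH (h (show s(x, y) ∈ G.edgeSet from hxy))

/-- Disjoint sets meeting a target `X` that has at most as many elements as there are sets meet it
in exactly one element each, and exhaust it. -/
theorem exists_unique_representatives {V : Type*} [Finite V] {k : ℕ} {X : Set V}
    (hX : X.ncard ≤ k) {f : Fin k → Set V} (hd : ∀ i j, i ≠ j → Disjoint (f i) (f j))
    (hf : ∀ i, (f i ∩ X).Nonempty) :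
    ∃ z : Fin k → V, (∀ i, z i ∈ f i) ∧ (∀ i, z i ∈ X) ∧ (∀ v ∈ X, ∃ i, z i = v) ∧
      ∀ i, ∀ v ∈ X, v ∈ f i → v = z i := by
  choose z hz using hf
  have huniq : ∀ i j v, v ∈ f i → v ∈ f j → i = j := fun i j v hi hj => by
    by_contra hij
    exact Set.disjoint_left.1 (hd i j hij) hi hj
  have hinj : Function.Injective z := fun i j hij =>
    huniq i j _ (hz i).1 (hij ▸ (hz j).1)
  have hrange : Set.range z = X := by
    apply Set.eq_of_subset_of_ncard_le (by rintro _ ⟨i, rfl⟩; exact (hz i).2) _ (Set.toFinite _)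
    rw [← Set.image_univ, Set.ncard_image_of_injective _ hinj]
    simpa using hX
  have hsurj : ∀ v ∈ X, ∃ i, z i = v := fun v hv => by rwa [← hrange] at hv
  refine ⟨z, fun i => (hz i).1, fun i => (hz i).2, hsurj, fun i v hv hvi => ?_⟩
  obtain ⟨j, rfl⟩ := hsurj v hv
  rw [huniq i j _ hvi (hz j).1]

/-- One half of the inductive step of Menger: the induction hypothesis is applied to the edges of
`G` inside `P`, with target `P ∩ Q` together with the end `x` of the deleted edge. -/
theorem exists_links_in_side {V : Type*} [Finite V] {G : SimpleGraph V} {A B : Set V} {k : ℕ}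
    (hG : G.SeparationsGE A B k)
    (ih : ∀ (H : SimpleGraph V) (A B : Set V), H.edgeSet.ncard < G.edgeSet.ncard →
      H.SeparationsGE A B k → H.HasLinks A B k)
    {x y : V} (hxy : G.Adj x y) {P Q : Set V} (hPQ : (G.deleteEdges {s(x, y)}).IsSeparation P Q)
    (hA : A ⊆ P) (hB : B ⊆ Q) (hk : (P ∩ Q).ncard < k)
    (hxP : x ∈ P) (hyP : y ∉ P) (hyQ : y ∈ Q) :
    ∃ (f : Fin k → Set V) (z : Fin k → V), (∀ i j, i ≠ j → Disjoint (f i) (f j)) ∧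
      (∀ i, (G.induce (f i)).Connected ∧ (f i ∩ A).Nonempty ∧ f i ⊆ P) ∧
      (∀ i, z i ∈ f i) ∧ (∀ i, z i ∈ insert x (P ∩ Q)) ∧ (∀ v ∈ insert x (P ∩ Q), ∃ i, z i = v) ∧
      ∀ i, ∀ v ∈ insert x (P ∩ Q), v ∈ f i → v = z i := by
  let H : SimpleGraph V := ((⊤ : G.Subgraph).induce P).spanningCoe
  have hadj : ∀ u v, H.Adj u v ↔ u ∈ P ∧ v ∈ P ∧ G.Adj u v := fun u v => by simp [H]
  have hle : H ≤ G := fun u v h => ((hadj u v).1 h).2.2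
  obtain ⟨f, hd, hf⟩ := ih H A (insert x (P ∩ Q))
    (deleteEdge_lt hxy hle fun h => hyP ((hadj _ _).1 h).2.1) <| by
    intro C D hCD hAC hXD
    have hsub : (C ∩ P) ∩ (D ∪ Q) ⊆ C ∩ D := by
      rintro v ⟨⟨hC, hP⟩, hD | hQ⟩
      · exact ⟨hC, hD⟩
      · exact ⟨hC, hXD (Or.inr ⟨hP, hQ⟩)⟩
    -- A separation of the side extends to one of `G` of no larger order. An edge from `P \ Q` out
    -- of `P` could only be `xy`, and `x ∈ D`.
    refine (hG (C ∩ P) (D ∪ Q) ⟨fun v => ?_, ?_⟩ (fun a ha => ⟨hAC ha, hA ha⟩)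
      (fun b hb => Or.inr (hB hb))).trans (Set.ncard_le_ncard hsub (Set.toFinite _))
    · have h1 := hPQ.cover v
      have h2 := hCD.cover v
      simp only [Set.mem_inter_iff, Set.mem_union]
      tauto
    · rintro u v ⟨huC, huP⟩ huDQ hv hvCP huv
      have huD : u ∉ D := fun h => huDQ (Or.inl h)
      have huQ : u ∉ Q := fun h => huDQ (Or.inr h)
      have hvP : v ∈ P := by
        by_contra hvP
        refine hPQ.not_adj u v huP huQ ((hPQ.cover v).resolve_left hvP) hvP ?_
        rw [deleteEdges_adj]
        refine ⟨huv, fun h => ?_⟩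
        rcases Sym2.eq_iff.1 (Set.mem_singleton_iff.1 h) with ⟨rfl, -⟩ | ⟨rfl, -⟩
        · exact huD (hXD (Or.inl rfl))
        · exact huQ hyQ
      have hvC : v ∉ C := fun h => hvCP ⟨h, hvP⟩
      exact hCD.not_adj u v huC huD ((hCD.cover v).resolve_left hvC) hvC
        ((hadj u v).2 ⟨huP, hvP, huv⟩)
  obtain ⟨z, hz⟩ := exists_unique_representatives
    ((Set.ncard_insert_le x (P ∩ Q)).trans hk) hd fun i => (hf i).2.2
  refine ⟨f, z, hd, fun i => ⟨(hf i).1.induce_mono_graph hle, (hf i).2.1, ?_⟩, hz⟩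
  obtain ⟨a, hai, haA⟩ := (hf i).2.1
  exact (hf i).1.subset_of_closed hai (hA haA) fun u _ _ v _ huv => ((hadj u v).1 huv).2.1

/-- Links on the two sides are glued at the vertices of `P ∩ Q`, and the link ending at `x` is
joined to the one ending at `y` through the edge `xy`. -/
theorem hasLinks_of_deleteEdge_separation {V : Type*} [Finite V] {G : SimpleGraph V}
    {A B : Set V} {k : ℕ} (hG : G.SeparationsGE A B k)
    (ih : ∀ (H : SimpleGraph V) (A B : Set V), H.edgeSet.ncard < G.edgeSet.ncard →
      H.SeparationsGE A B k → H.HasLinks A B k)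
    {x y : V} (hxy : G.Adj x y) {P Q : Set V} (hPQ : (G.deleteEdges {s(x, y)}).IsSeparation P Q)
    (hA : A ⊆ P) (hB : B ⊆ Q) (hk : (P ∩ Q).ncard < k)
    (hxP : x ∈ P) (hxQ : x ∉ Q) (hyP : y ∉ P) (hyQ : y ∈ Q) : G.HasLinks A B k := by
  obtain ⟨f, z, hfd, hf, hzf, hzX, hzs, hzu⟩ :=
    exists_links_in_side hG ih hxy hPQ hA hB hk hxP hyP hyQ
  obtain ⟨g, w, hgd, hg, hwg, hwY, hws, hwu⟩ :=
    exists_links_in_side hG.swap ih hxy.symm (by rw [Sym2.eq_swap]; exact hPQ.swap) hB hA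
      (by rwa [Set.inter_comm]) hyQ hxQ hxP
  rw [Set.inter_comm] at hwY hws hwu
  have hmatch : ∀ i, ∃ j, (z i = x ∧ w j = y) ∨ (z i ∈ P ∩ Q ∧ w j = z i) := fun i => by
    rcases hzX i with h | h
    · obtain ⟨j, hj⟩ := hws y (Or.inl rfl)
      exact ⟨j, Or.inl ⟨h, hj⟩⟩
    · obtain ⟨j, hj⟩ := hws (z i) (Or.inr h)
      exact ⟨j, Or.inr ⟨h, hj⟩⟩
  choose σ hσ using hmatch
  have hzinj : ∀ i j, z i = z j → i = j := fun i j h => by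
    by_contra hij
    exact Set.disjoint_left.1 (hfd i j hij) (hzf i) (h ▸ hzf j)
  have hσinj : ∀ i j, σ i = σ j → i = j := fun i j h => by
    apply hzinj
    have hi := hσ i
    have hj := hσ j
    rw [← h] at hj
    rcases hi with ⟨h1, h2⟩ | ⟨h1, h2⟩ <;> rcases hj with ⟨h3, h4⟩ | ⟨h3, h4⟩
    · rw [h1, h3]
    · exact absurd (show y ∈ P by rw [← h2, h4]; exact h3.1) hyP
    · exact absurd (show y ∈ P by rw [← h4, h2]; exact h1.1) hyP
    · rw [← h2, h4]
  -- A common vertex lies in `P ∩ Q`, where each link has only its representative, so the indices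
  -- agree.
  have hcross : ∀ i j, i ≠ j → Disjoint (f i) (g (σ j)) := fun i j hij => by
    refine Set.disjoint_left.2 fun v hv hv' => hij (hzinj i j ?_)
    have hvS : v ∈ P ∩ Q := ⟨(hf i).2.2 hv, (hg (σ j)).2.2 hv'⟩
    have h1 := hzu i v (Or.inr hvS) hv
    have h2 := hwu (σ j) v (Or.inr hvS) hv'
    rcases hσ j with ⟨-, h4⟩ | ⟨-, h4⟩
    · exact absurd (h4 ▸ h2 ▸ hvS).1 hyP
    · rw [← h1, h2, h4]
  refine ⟨fun i => f i ∪ g (σ i), fun i j hij => ?_, fun i => ⟨?_, ?_, ?_⟩⟩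
  · rw [Set.disjoint_union_left, Set.disjoint_union_right, Set.disjoint_union_right]
    exact ⟨⟨hfd i j hij, hcross i j hij⟩, (hcross j i hij.symm).symm,
      hgd _ _ fun h => hij (hσinj i j h)⟩
  · rcases hσ i with ⟨h1, h2⟩ | ⟨-, h2⟩
    · exact connected_induce_union (hf i).1.preconnected (hg (σ i)).1.preconnected (hzf i)
        (hwg (σ i)) (by rw [h1, h2]; exact hxy)
    · exact induce_union_connected (hf i).1.preconnected (hg (σ i)).1.preconnected
        ⟨z i, hzf i, h2 ▸ hwg (σ i)⟩
  · exact (hf i).2.1.mono (Set.inter_subset_inter_left _ Set.subset_union_left)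
  · exact (hg (σ i)).2.1.mono (Set.inter_subset_inter_left _ Set.subset_union_right)

/-- Menger's theorem, with connected sets in place of paths. -/
theorem SeparationsGE.hasLinks {V : Type*} [Finite V] {G : SimpleGraph V} {A B : Set V} {k : ℕ}
    (hG : G.SeparationsGE A B k) : G.HasLinks A B k := by
  induction hn : G.edgeSet.ncard using Nat.strong_induction_on generalizing G A B with
  | _ n ih =>
  subst hn
  have ih' : ∀ (H : SimpleGraph V) (A B : Set V), H.edgeSet.ncard < G.edgeSet.ncard →
      H.SeparationsGE A B k → H.HasLinks A B k := fun H A B hlt hH => ih _ hlt hH rfl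
  by_cases hE : ∃ x y, G.Adj x y
  · obtain ⟨x, y, hxy⟩ := hE
    by_cases hdel : (G.deleteEdges {s(x, y)}).SeparationsGE A B k
    · exact (ih' _ A B (deleteEdge_lt hxy (deleteEdges_le _) (by simp)) hdel).mono
        (deleteEdges_le _)
    · simp only [SeparationsGE, not_forall, not_le] at hdel
      obtain ⟨P, Q, hPQ, hA, hB, hk⟩ := hdel
      have hnot : ¬ G.IsSeparation P Q := fun h => (hG P Q h hA hB).not_gt hk
      have hex : ∃ u v, u ∈ P ∧ u ∉ Q ∧ v ∈ Q ∧ v ∉ P ∧ G.Adj u v := by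
        by_contra hcon
        push Not at hcon
        exact hnot ⟨hPQ.cover, hcon⟩
      obtain ⟨u, v, huP, huQ, hvQ, hvP, huv⟩ := hex
      have he : s(u, v) = s(x, y) := by
        by_contra hne
        exact hPQ.not_adj u v huP huQ hvQ hvP ((deleteEdges_adj ..).2 ⟨huv, hne⟩)
      rw [← he] at hPQ
      exact hasLinks_of_deleteEdge_separation hG ih' huv hPQ hA hB hk huP huQ hvP hvQ
  · push Not at hE
    -- Without edges every cover is a separation; this one has order `|A ∩ B|`, so single vertices
    -- of `A ∩ B` serve as links.
    have hk : k ≤ (A ∩ (B ∪ Aᶜ)).ncard :=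
      hG A (B ∪ Aᶜ) ⟨fun v => by simp only [Set.mem_union, Set.mem_compl_iff]; tauto,
        fun u v _ _ _ _ => hE u v⟩ subset_rfl Set.subset_union_left
    obtain ⟨T, hT, hTk⟩ := Set.exists_subset_card_eq hk
    have e : Fin k ≃ T := (Finite.equivFinOfCardEq hTk).symm
    refine ⟨fun i => {(e i : V)}, fun i j hij => ?_,
      fun i => ⟨connected_induce_singleton G _, ?_, ?_⟩⟩
    · rw [Set.disjoint_singleton]
      exact fun h => hij (e.injective (Subtype.ext h))
    · exact ⟨e i, rfl, (hT (e i).2).1⟩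
    · exact ⟨e i, rfl, (hT (e i).2).2.resolve_right fun h => h (hT (e i).2).1⟩

/-! ### Minors from branch sets -/

/-- A graph `H` is a minor of `G` if it has a model in `G`: disjoint connected branch sets, joined
by an edge whenever the corresponding vertices of `H` are adjacent. -/
theorem isMinorOf_of_branchSets {ι V : Type*} {G : SimpleGraph V} {H : SimpleGraph ι}
    (f : ι → Set V) (hd : ∀ i j, i ≠ j → Disjoint (f i) (f j))
    (hc : ∀ i, (G.induce (f i)).Connected)
    (hadj : ∀ i j, H.Adj i j → ∃ u ∈ f i, ∃ v ∈ f j, G.Adj u v) : H.IsMinorOf G := by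
  have huniq : ∀ {i j v}, v ∈ f i → v ∈ f j → i = j := fun {i j v} hi hj => by
    by_contra hij
    exact Set.disjoint_left.1 (hd i j hij) hi hj
  -- Edges between branch sets whose indices are not adjacent in `H` are left out, so that the
  -- contraction is exactly `H`.
  let K : G.Subgraph :=
    { verts := {v | ∃ i, v ∈ f i}
      Adj := fun u v => G.Adj u v ∧ ∃ i j, u ∈ f i ∧ v ∈ f j ∧ (i = j ∨ H.Adj i j)
      adj_sub := fun h => h.1
      edge_vert := fun h => by
        obtain ⟨-, i, j, hi, -⟩ := h
        exact ⟨i, hi⟩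
      symm := ⟨fun u v h => by
        obtain ⟨h, i, j, hi, hj, hij⟩ := h
        exact ⟨h.symm, j, i, hj, hi, hij.imp Eq.symm fun h => h.symm⟩⟩ }
  have hidx : ∀ v : K.verts, ∃ i, (v : V) ∈ f i := fun v => v.2
  choose idx hidx using hidx
  have hidx_eq : ∀ {v : K.verts} {i}, (v : V) ∈ f i → idx v = i := fun h => huniq (hidx _) h
  -- The components of `F` are exactly the branch sets.
  let F : Set (Sym2 K.verts) := {e ∈ K.coe.edgeSet | ∀ u ∈ e, ∀ v ∈ e, idx u = idx v}
  have hF : ∀ u v : K.verts, (fromEdgeSet F).Adj u v ↔ G.Adj u v ∧ idx u = idx v := fun u v => by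
    rw [fromEdgeSet_adj]
    constructor
    · rintro ⟨⟨h1, h2⟩, -⟩
      exact ⟨K.adj_sub h1, h2 u (by simp) v (by simp)⟩
    · rintro ⟨h1, h2⟩
      refine ⟨⟨⟨h1, idx u, idx v, hidx u, hidx v, Or.inl h2⟩, ?_⟩, fun h => h1.ne (congrArg _ h)⟩
      intro a ha b hb
      rcases Sym2.mem_iff.1 ha with rfl | rfl <;> rcases Sym2.mem_iff.1 hb with rfl | rfl <;>
        simp [h2]
  have hreach : ∀ u v : K.verts, (fromEdgeSet F).Reachable u v ↔ idx u = idx v := fun u v => by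
    constructor
    · rintro ⟨p⟩
      induction p with
      | nil => rfl
      | cons h _ ih => exact ((hF _ _).1 h).2.trans ih
    · intro h
      let φ : G.induce (f (idx u)) →g fromEdgeSet F :=
        { toFun := fun w => ⟨w, idx u, w.2⟩
          map_rel' := fun {a b} hab => (hF _ _).2 ⟨hab,
            (hidx_eq (i := idx u) a.2).trans (hidx_eq (i := idx u) b.2).symm⟩ }
      exact ((hc (idx u)).preconnected ⟨u, hidx u⟩ ⟨v, h ▸ hidx v⟩).map φ
  have hne : ∀ i, ∃ v : K.verts, idx v = i := fun i => by
    obtain ⟨v, hv⟩ := (hc i).nonempty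
    exact ⟨⟨v, i, hv⟩, hidx_eq hv⟩
  choose rep hrep using hne
  let e : ι ≃ (fromEdgeSet F).ConnectedComponent :=
    { toFun := fun i => (fromEdgeSet F).connectedComponentMk (rep i)
      invFun := ConnectedComponent.lift idx fun u v p _ => (hreach u v).1 ⟨p⟩
      left_inv := hrep
      right_inv := fun C => by
        induction C using ConnectedComponent.ind with
        | _ v => exact ConnectedComponent.sound ((hreach _ _).2 (hrep _)) }
  have he : ∀ (v : K.verts) i, (fromEdgeSet F).connectedComponentMk v = e i ↔ idx v = i :=
    fun v i => by
      change _ = (fromEdgeSet F).connectedComponentMk (rep i) ↔ _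
      rw [ConnectedComponent.eq, hreach, hrep]
  refine ⟨K, F, fun _ h => h.1, ⟨e, ?_⟩⟩
  intro i j
  constructor
  · rintro ⟨hij, u, v, hu, hv, huv⟩
    obtain ⟨-, i', j', hi, hj, h⟩ := huv
    have hi' : i' = i := (hidx_eq hi).symm.trans ((he u i).1 hu)
    have hj' : j' = j := (hidx_eq hj).symm.trans ((he v j).1 hv)
    subst hi' hj'
    exact h.resolve_left fun h => hij (congrArg e h)
  · intro hij
    obtain ⟨u, hu, v, hv, huv⟩ := hadj i j hij
    exact ⟨fun h => hij.ne (e.injective h), ⟨u, i, hu⟩, ⟨v, j, hv⟩, (he _ _).2 (hidx_eq hu),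
      (he _ _).2 (hidx_eq hv), huv, i, j, hu, hv, Or.inr hij⟩

/-- A model of a complete graph on `t` vertices in which at most `s` pairs of branch sets lack
an edge. -/
theorem hasCompleteMinusMinor_of_branchSets {ι V : Type*} [Fintype ι]
    {G : SimpleGraph V} {t s : ℕ} (ht : Fintype.card ι = t) (hst : s ≤ t.choose 2)
    (f : ι → Set V) (hd : ∀ i j, i ≠ j → Disjoint (f i) (f j))
    (hc : ∀ i, (G.induce (f i)).Connected) (D : Finset (Sym2 ι)) (hD : D.card ≤ s)
    (hadj : ∀ i j, i ≠ j → s(i, j) ∉ D → ∃ u ∈ f i, ∃ v ∈ f j, G.Adj u v) :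
    G.HasCompleteMinusMinor t s := by
  classical
  let e : ι ≃ Fin t := Fintype.equivFinOfCardEq ht
  let D₀ : Finset (Sym2 (Fin t)) := (D.image (Sym2.map e)).filter fun x => ¬ x.IsDiag
  have hsub : D₀ ⊆ (completeGraph (Fin t)).edgeFinset := fun x hx => by
    have := (Finset.mem_filter.1 hx).2
    simpa [completeGraph_eq_top] using this
  -- Exactly `s` edges must be deleted; enlarging the deleted set only weakens the adjacencies
  -- required.
  obtain ⟨D₁, h01, h1, hcard⟩ := Finset.exists_subsuperset_card_eq hsub
    ((Finset.card_filter_le _ _).trans (Finset.card_image_le.trans hD))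
    (by
      have h := card_edgeFinset_top_eq_card_choose_two (V := Fin t)
      rw [Fintype.card_fin] at h
      exact hst.trans_eq (h.symm.trans (by congr!)))
  refine ⟨_, ⟨D₁, fun x hx => mem_edgeFinset.1 (h1 hx), hcard, rfl⟩,
    isMinorOf_of_branchSets (fun i => f (e.symm i))
      (fun i j hij => hd _ _ (e.symm.injective.ne hij)) (fun i => hc _) fun i j hij => ?_⟩
  rw [deleteEdges_adj] at hij
  obtain ⟨hne, hnD⟩ := hij
  have hne : i ≠ j := hne.ne
  refine hadj _ _ (e.symm.injective.ne hne) fun h => hnD (h01 ?_)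
  refine Finset.mem_filter.2 ⟨Finset.mem_image.2 ⟨_, h, by simp⟩, by simpa using hne⟩

/-! ### Eight dense vertices and an outside component -/

/-- An eight-vertex set missing at most five edges, together with a component of the remaining
graph, gives a `K₉` minor missing at most six edges. -/
theorem hasCompleteMinusMinor_of_eight {V : Type*} [Fintype V] [DecidableEq V]
    {G : SimpleGraph V} (hconn : G.IsKConnected 7) (hcard : 9 ≤ Fintype.card V)
    {S : Finset V} (hS : S.card = 8) (D : Finset (Sym2 V)) (hD : D.card ≤ 5)
    (hadj : ∀ u ∈ S, ∀ v ∈ S, u ≠ v → s(u, v) ∉ D → G.Adj u v) :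
    G.HasCompleteMinusMinor 9 6 := by
  classical
  obtain ⟨r, hr⟩ : ∃ r, r ∉ S := by
    by_contra! h
    have := Finset.card_le_card (show Finset.univ ⊆ S from fun v _ => h v)
    rw [Finset.card_univ] at this
    omega
  let C : Set V := {v | ∃ p : G.Walk r v, ∀ w ∈ p.support, w ∉ S}
  have hrC : r ∈ C := ⟨.nil, by simpa using hr⟩
  have hCS : ∀ v ∈ C, v ∉ S := fun v ⟨p, hp⟩ => hp v p.end_mem_support
  have hclosed : ∀ u ∈ C, ∀ v, v ∉ S → G.Adj u v → v ∈ C := by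
    rintro u ⟨p, hp⟩ v hv huv
    refine ⟨p.concat huv, fun w hw => ?_⟩
    rw [Walk.support_concat, List.mem_append, List.mem_singleton] at hw
    rcases hw with hw | rfl
    exacts [hp w hw, hv]
  have hCconn : (G.induce C).Connected := by
    refine G.induce_connected_of_patches r hrC fun {v} hv => ?_
    obtain ⟨p, hp⟩ := hv
    refine ⟨{w | w ∈ p.support}, fun w hw => ?_, p.start_mem_support, p.end_mem_support,
      p.connected_induce_support.preconnected _ _⟩
    exact ⟨p.takeUntil w hw, fun x hx => hp x (p.support_takeUntil_subset_support hw hx)⟩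
  let N : Finset V := S.filter fun s => ∀ u ∈ C, ¬ G.Adj u s
  -- If two vertices of `S` had no neighbour in `C`, deleting the other six would cut `C` off from
  -- them.
  have hN : N.card ≤ 1 := by
    rw [Finset.card_le_one]
    by_contra! hcon
    obtain ⟨a, ha, b, hb, hab⟩ := hcon
    rw [Finset.mem_filter] at ha hb
    have hcardT : ((S.erase a).erase b).card < 7 := by
      rw [Finset.card_erase_of_mem (Finset.mem_erase.2 ⟨hab.symm, hb.1⟩),
        Finset.card_erase_of_mem ha.1, hS]
      norm_num
    have hsub := (hconn.2 _ hcardT).subset_of_closed (a := r) (D := C) (by simp [hr]) hrC <| by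
      intro u _ hu v hv huv
      by_cases hvS : v ∈ S
      · have hva : v ≠ a := fun h => ha.2 u hu (h ▸ huv)
        have hvb : v ≠ b := fun h => hb.2 u hu (h ▸ huv)
        exact absurd (by simp [hvS, hva, hvb]) hv
      · exact hclosed u hu v hvS huv
    exact hCS a (hsub (by simp)) ha.1
  let f : Option S → Set V := fun o => o.elim C fun s => {(s : V)}
  -- The root `r` stands for the whole branch set `C`, so exceptional pairs can be recorded as pairs
  -- of vertices.
  let g : Option S → V := fun o => o.elim r fun s => s
  have hg : Function.Injective g := by
    rintro (_ | a) (_ | b) h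
    · rfl
    · exact absurd ((show r = b from h) ▸ b.2) hr
    · exact absurd ((show (a : V) = r from h) ▸ a.2) hr
    · exact congrArg some (Subtype.ext h)
  have hginj := Sym2.map.injective hg
  refine hasCompleteMinusMinor_of_branchSets (ι := Option S) (by simp [hS]) (by decide) f ?_ ?_
    ((D ∪ N.image fun v => s(r, v)).preimage (Sym2.map g) hginj.injOn) ?_ ?_
  · rintro (_ | a) (_ | b) hab
    · exact absurd rfl hab
    · exact Set.disjoint_singleton_right.2 fun h => hCS _ h b.2
    · exact Set.disjoint_singleton_left.2 fun h => hCS _ h a.2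
    · exact Set.disjoint_singleton.2 fun h => hab (congrArg some (Subtype.ext h))
  · rintro (_ | a)
    exacts [hCconn, connected_induce_singleton G _]
  · rw [← Finset.card_image_of_injective _ hginj]
    refine (Finset.card_le_card (Finset.image_subset_iff.2 fun x hx =>
      Finset.mem_preimage.1 hx)).trans ((Finset.card_union_le _ _).trans ?_)
    exact Nat.add_le_add hD (Finset.card_image_le.trans hN)
  · have key : ∀ b : S, s(r, (b : V)) ∉ N.image (fun v => s(r, v)) → ∃ u ∈ C, G.Adj u b := by
      intro b hb
      by_contra! hcon
      exact hb (Finset.mem_image.2 ⟨b, Finset.mem_filter.2 ⟨b.2, hcon⟩, rfl⟩)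
    rintro (_ | a) (_ | b) hab hnD <;>
      simp only [Finset.mem_preimage, Finset.mem_union, not_or, Sym2.map_mk] at hnD
    · exact absurd rfl hab
    · obtain ⟨u, hu, hub⟩ := key b hnD.2
      exact ⟨u, hu, b, rfl, hub⟩
    · obtain ⟨u, hu, hub⟩ := key a (by rw [Sym2.eq_swap]; exact hnD.2)
      exact ⟨a, rfl, u, hu, hub.symm⟩
    · exact ⟨a, rfl, b, rfl, hadj a a.2 b b.2
        (fun h => hab (congrArg some (Subtype.ext h))) hnD.1⟩

/-! ### Two cliques with small intersection -/

/-- In a connected set, some connected subset avoiding `a` and containing `b` is joined to `a`. -/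
theorem exists_connected_subset_adj {V : Type*} {G : SimpleGraph V} {s : Set V}
    (hs : (G.induce s).Connected) {a b : V} (ha : a ∈ s) (hb : b ∈ s) (hab : a ≠ b) :
    ∃ C ⊆ s, a ∉ C ∧ b ∈ C ∧ (G.induce C).Connected ∧ ∃ c ∈ C, G.Adj a c := by
  classical
  obtain ⟨p, hp⟩ := (hs.preconnected ⟨a, ha⟩ ⟨b, hb⟩).exists_isPath
  cases p with
  | nil => exact absurd rfl hab
  | @cons _ w _ h q =>
    -- A path from `a` to `b` with its first vertex removed.
    let q' : G.Walk w b := q.map (Embedding.induce s).toHom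
    have hmem : ∀ x ∈ q'.support, ∃ y ∈ q.support, (y : V) = x := fun x hx => by
      have hx' := (Walk.support_map (Embedding.induce s).toHom q) ▸ hx
      exact List.mem_map.1 hx'
    refine ⟨{v | v ∈ q'.support}, fun x hx => ?_, fun hx => ?_, q'.end_mem_support,
      q'.connected_induce_support, w, q'.start_mem_support, h⟩
    · obtain ⟨y, -, rfl⟩ := hmem x hx
      exact y.2
    · obtain ⟨y, hy, hya⟩ := hmem a hx
      rw [Walk.cons_isPath_iff] at hp
      exact hp.2 ((Subtype.ext hya : y = ⟨a, ha⟩) ▸ hy)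

/-- A smaller `P ∩ Q` would miss a vertex of `A` and one of `B`, and its deletion would disconnect
them. -/
theorem IsKConnected.separationsGE {V : Type*} [Fintype V] {G : SimpleGraph V} {k m : ℕ}
    (hconn : G.IsKConnected k) (hm : m ≤ k) {A B : Finset V} (hA : m ≤ A.card) (hB : m ≤ B.card) :
    G.SeparationsGE A B m := by
  classical
  intro P Q hPQ hAP hBQ
  by_contra! hlt
  let S : Finset V := (P ∩ Q).toFinset
  have hS : S.card < m := by rwa [← Set.ncard_eq_toFinset_card']
  have hmemS : ∀ v, v ∈ S ↔ v ∈ P ∧ v ∈ Q := fun v => by simp [S]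
  obtain ⟨a, haA, haS⟩ := Finset.exists_mem_notMem_of_card_lt_card (hS.trans_le hA)
  obtain ⟨b, hbB, hbS⟩ := Finset.exists_mem_notMem_of_card_lt_card (hS.trans_le hB)
  have hsub := (hconn.2 S (hS.trans_le hm)).subset_of_closed (a := a) (D := P) haS (hAP haA) <| by
    intro u huS hu v hv huv
    by_contra hvP
    have hvQ := (hPQ.cover v).resolve_left hvP
    by_cases huQ : u ∈ Q
    · exact huS ((hmemS u).2 ⟨hu, huQ⟩)
    · exact hPQ.not_adj u v hu huQ hvQ hvP huv
  exact hbS ((hmemS b).2 ⟨hsub hbS, hBQ hbB⟩)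

/-- Six disjoint connected sets linking two 6-cliques with at most three common vertices give
a `K₉` minor missing at most six edges. -/
theorem hasCompleteMinusMinor_of_inter_le {V : Type*} [Fintype V] [DecidableEq V]
    {G : SimpleGraph V} (hconn : G.IsKConnected 7) {A B : Finset V}
    (hA : G.IsNClique 6 A) (hB : G.IsNClique 6 B) (hAB : (A ∩ B).card ≤ 3) :
    G.HasCompleteMinusMinor 9 6 := by
  classical
  obtain ⟨f, hd, hf⟩ :=
    (hconn.separationsGE (m := 6) (by norm_num) hA.card_eq.ge hB.card_eq.ge).hasLinks
  obtain ⟨a, haf, haA, -, -⟩ :=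
    exists_unique_representatives (by simp [hA.card_eq]) hd fun i => (hf i).2.1
  obtain ⟨b, hbf, hbB, -, -⟩ :=
    exists_unique_representatives (by simp [hB.card_eq]) hd fun i => (hf i).2.2
  have hinj : ∀ g : Fin 6 → V, (∀ i, g i ∈ f i) → Function.Injective g := fun g hg i j hij => by
    by_contra hne
    exact Set.disjoint_left.1 (hd i j hne) (hg i) (hij ▸ hg j)
  have ha := hinj a haf
  have hb := hinj b hbf
  -- Links with equal ends inject into `A ∩ B`, so at most three of the six have equal ends.
  have hcount : 3 ≤ (Finset.univ.filter fun i => a i ≠ b i).card := by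
    have h1 : (Finset.univ.filter fun i => a i = b i).card ≤ (A ∩ B).card := by
      refine Finset.card_le_card_of_injOn a (fun i hi => ?_) ha.injOn
      have hi : a i = b i := by simpa using hi
      exact Finset.mem_inter.2 ⟨haA i, hi ▸ hbB i⟩
    have h2 := Finset.card_filter_add_card_filter_not (s := Finset.univ) fun i => a i = b i
    rw [Finset.card_univ, Fintype.card_fin] at h2
    simp only [ne_eq]
    omega
  obtain ⟨T, hTsub, hT⟩ := Finset.exists_subset_card_eq hcount
  have hne : ∀ i : T, a i ≠ b i := fun i => (Finset.mem_filter.1 (hTsub i.2)).2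
  choose C hCf haC hbC hCconn c hcC hac using fun i : T =>
    exists_connected_subset_adj (hf i).1 (haf i) (hbf i) (hne i)
  let g : Fin 6 → Set V := fun i => if i ∈ T then {a i} else f i
  have hgT : ∀ i ∈ T, g i = {a i} := fun i hi => if_pos hi
  have hgT' : ∀ i ∉ T, g i = f i := fun i hi => if_neg hi
  have hgf : ∀ i, g i ⊆ f i := fun i => by
    by_cases hi : i ∈ T
    · rw [hgT i hi]
      exact Set.singleton_subset_iff.2 (haf i)
    · rw [hgT' i hi]
  have hag : ∀ i, a i ∈ g i := fun i => by
    by_cases hi : i ∈ T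
    · rw [hgT i hi]
      exact rfl
    · rw [hgT' i hi]
      exact haf i
  have hcross : ∀ (i : Fin 6) (j : T), Disjoint (g i) (C j) := fun i j => by
    by_cases hij : i = j
    · subst hij
      rw [hgT _ j.2]
      exact Set.disjoint_singleton_left.2 (haC j)
    · exact (hd i j hij).mono (hgf i) (hCf j)
  -- A split link's two pieces are joined along the link; an unsplit link still contains its end in
  -- `B`, which is adjacent to `b j`.
  have hmixed : ∀ (i : Fin 6) (j : T), (∀ h : i ∈ T, (⟨i, h⟩ : T) = j) →
      ∃ u ∈ g i, ∃ v ∈ C j, G.Adj u v := fun i j h => by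
    by_cases hi : i ∈ T
    · obtain rfl := h hi
      exact ⟨a i, hag i, c _, hcC _, hac ⟨i, hi⟩⟩
    · exact ⟨b i, by rw [hgT' i hi]; exact hbf i, b j, hbC j,
        hB.isClique (hbB i) (hbB j) (hb.ne fun hij => hi (hij ▸ j.2))⟩
  refine hasCompleteMinusMinor_of_branchSets (ι := Fin 6 ⊕ T) (by simp [hT]) (by decide)
    (Sum.elim g C) ?_ ?_
    ((Finset.univ : Finset T).offDiag.image fun p => s(Sum.inl (p.1 : Fin 6), Sum.inr p.2)) ?_ ?_
  · rintro (i | i) (j | j) hij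
    · exact (hd i j fun h => hij (congrArg _ h)).mono (hgf i) (hgf j)
    · exact hcross i j
    · exact (hcross j i).symm
    · exact (hd i j fun h => hij (congrArg _ (Subtype.ext h))).mono (hCf i) (hCf j)
  · rintro (i | i)
    · change (G.induce (g i)).Connected
      by_cases hi : i ∈ T
      · rw [hgT i hi]
        exact connected_induce_singleton G _
      · rw [hgT' i hi]
        exact (hf i).1
    · exact hCconn i
  · refine Finset.card_image_le.trans ?_
    rw [Finset.offDiag_card, Finset.card_univ, Fintype.card_coe, hT]
  · rintro (i | i) (j | j) hij hnD
    · exact ⟨a i, hag i, a j, hag j,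
        hA.isClique (haA i) (haA j) (ha.ne fun h => hij (congrArg _ h))⟩
    · refine hmixed i j fun hi => ?_
      by_contra hne
      exact hnD (Finset.mem_image.2 ⟨(⟨i, hi⟩, j), by simpa using hne, rfl⟩)
    · obtain ⟨u, hu, v, hv, huv⟩ := hmixed j i fun hj => by
        by_contra hne
        exact hnD (Finset.mem_image.2 ⟨(⟨j, hj⟩, i), by simpa using hne, Sym2.eq_swap⟩)
      exact ⟨v, hv, u, hu, huv.symm⟩
    · exact ⟨b i, hbC i, b j, hbC j,
        hB.isClique (hbB i) (hbB j) (hb.ne fun h => hij (congrArg _ (Subtype.ext h)))⟩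

/-! ### Cliques with large intersection -/

/-- Two 6-cliques with four common vertices span eight vertices missing at most four edges. -/
theorem hasCompleteMinusMinor_of_inter_eq_four {V : Type*} [Fintype V] [DecidableEq V]
    {G : SimpleGraph V} (hconn : G.IsKConnected 7) (hcard : 9 ≤ Fintype.card V) {A B : Finset V}
    (hA : G.IsNClique 6 A) (hB : G.IsNClique 6 B) (hAB : (A ∩ B).card = 4) :
    G.HasCompleteMinusMinor 9 6 := by
  have h1 := Finset.card_union_add_card_inter A B
  have h2 := Finset.card_sdiff_add_card_inter A B
  have h3 := Finset.card_sdiff_add_card_inter B A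
  rw [Finset.inter_comm] at h3
  rw [hA.card_eq] at h1 h2
  rw [hB.card_eq] at h1 h3
  have h4 : (A \ B).card = 2 := by omega
  have h5 : (B \ A).card = 2 := by omega
  refine hasCompleteMinusMinor_of_eight hconn hcard (S := A ∪ B) (by omega)
    (((A \ B) ×ˢ (B \ A)).image fun p => s(p.1, p.2)) ?_ ?_
  · refine Finset.card_image_le.trans ?_
    rw [Finset.card_product, h4, h5]
    norm_num
  · intro u hu v hv huv hD
    have hD' : ∀ x ∈ A, x ∉ B → ∀ y ∈ B, y ∉ A → s(u, v) ≠ s(x, y) := fun x hx hx' y hy hy' h =>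
      hD (Finset.mem_image.2 ⟨(x, y), by simp [hx, hx', hy, hy'], h.symm⟩)
    rw [Finset.mem_union] at hu hv
    by_cases hAA : u ∈ A ∧ v ∈ A
    · exact hA.isClique hAA.1 hAA.2 huv
    by_cases hBB : u ∈ B ∧ v ∈ B
    · exact hB.isClique hBB.1 hBB.2 huv
    by_cases huA : u ∈ A
    · exact absurd rfl (hD' u huA (by tauto) v (by tauto) (by tauto))
    · exact absurd Sym2.eq_swap (hD' v (by tauto) (by tauto) u (by tauto) huA)

theorem exists_eq_insert_of_inter_eq_five {V : Type*} [DecidableEq V] {A B : Finset V}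
    (hA : A.card = 6) (hAB : (A ∩ B).card = 5) : ∃ a ∉ B, A = insert a (A ∩ B) := by
  have h := Finset.card_sdiff_add_card_inter A B
  obtain ⟨a, ha⟩ := Finset.card_eq_one.1 (show (A \ B).card = 1 by omega)
  refine ⟨a, (Finset.mem_sdiff.1 (ha.symm ▸ Finset.mem_singleton_self a)).2, ?_⟩
  rw [Finset.insert_eq, ← ha, Finset.sdiff_union_inter]

/-- Three 6-cliques sharing five vertices span eight vertices missing at most three edges. -/
theorem hasCompleteMinusMinor_of_common_five {V : Type*} [Fintype V] [DecidableEq V]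
    {G : SimpleGraph V} (hconn : G.IsKConnected 7) (hcard : 9 ≤ Fintype.card V)
    {C : Finset V} {a b c : V} (hC : C.card = 5) (ha : a ∉ C) (hb : b ∉ C) (hc : c ∉ C)
    (hab : a ≠ b) (hac : a ≠ c) (hbc : b ≠ c) (hA : G.IsClique (insert a C : Finset V))
    (hB : G.IsClique (insert b C : Finset V)) (hC' : G.IsClique (insert c C : Finset V)) :
    G.HasCompleteMinusMinor 9 6 := by
  refine hasCompleteMinusMinor_of_eight hconn hcard (S := insert a (insert b (insert c C))) ?_
    {s(a, b), s(a, c), s(b, c)} (Finset.card_le_three.trans (by norm_num)) ?_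
  · simp [*]
  · intro u hu v hv huv hD
    simp only [Finset.mem_insert, Finset.mem_singleton, not_or] at hu hv hD
    have key : ∀ x, G.IsClique (insert x C : Finset V) → (u = x ∨ u ∈ C) → (v = x ∨ v ∈ C) →
        G.Adj u v := fun x hx hu hv =>
      hx (by simpa using hu) (by simpa using hv) huv
    obtain ⟨h1, h2, h3⟩ := hD
    rcases hu with rfl | rfl | rfl | hu <;> rcases hv with rfl | rfl | rfl | hv <;>
      first
      | exact absurd rfl huv
      | exact absurd rfl h1
      | exact absurd rfl h2
      | exact absurd rfl h3
      | exact absurd Sym2.eq_swap h1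
      | exact absurd Sym2.eq_swap h2
      | exact absurd Sym2.eq_swap h3
      | (refine key _ hA ?_ ?_ <;> first | exact Or.inl rfl | exact Or.inr (by assumption))
      | (refine key _ hB ?_ ?_ <;> first | exact Or.inl rfl | exact Or.inr (by assumption))
      | (refine key _ hC' ?_ ?_ <;> first | exact Or.inl rfl | exact Or.inr (by assumption))

/-! ### Case analysis on the intersections -/

/-- Two 6-cliques, one not contained in the other, either give the minor or share five vertices. -/
theorem hasCompleteMinusMinor_or_inter_eq_five {V : Type*} [Fintype V] [DecidableEq V]
    {G : SimpleGraph V} (hconn : G.IsKConnected 7) (hcard : 9 ≤ Fintype.card V) {A B : Finset V}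
    (hA : G.IsNClique 6 A) (hB : G.IsNClique 6 B) (hAB : 1 ≤ (A \ B).card) :
    G.HasCompleteMinusMinor 9 6 ∨ (A ∩ B).card = 5 := by
  have h := Finset.card_sdiff_add_card_inter A B
  rw [hA.card_eq] at h
  rcases le_or_gt (A ∩ B).card 3 with h3 | h3
  · exact Or.inl (hasCompleteMinusMinor_of_inter_le hconn hA hB h3)
  rcases eq_or_ne (A ∩ B).card 4 with h4 | h4
  · exact Or.inl (hasCompleteMinusMinor_of_inter_eq_four hconn hcard hA hB h4)
  · exact Or.inr (by omega)

end SimpleGraph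

open SimpleGraph in
theorem lemmal {V : Type*} [Fintype V] [DecidableEq V] (G : SimpleGraph V)
    (hconn : G.IsKConnected 7) (hcard : 19 ≤ Fintype.card V)
    (L₁ L₂ L₃ : Finset V)
    (h₁ : G.IsNClique 6 L₁) (h₂ : G.IsNClique 6 L₂) (h₃ : G.IsNClique 6 L₃)
    (hL : 1 ≤ min (L₁ \ (L₂ ∪ L₃)).card
      (min (L₂ \ (L₁ ∪ L₃)).card (L₃ \ (L₁ ∪ L₂)).card)) :
    G.HasCompleteMinusMinor 9 6 := by
  obtain ⟨hL₁, hL₂, hL₃⟩ : 1 ≤ (L₁ \ (L₂ ∪ L₃)).card ∧ 1 ≤ (L₂ \ (L₁ ∪ L₃)).card ∧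
      1 ≤ (L₃ \ (L₁ ∪ L₂)).card := by simpa only [le_min_iff] using hL
  have h9 : 9 ≤ Fintype.card V := by omega
  rcases hasCompleteMinusMinor_or_inter_eq_five hconn h9 h₁ h₂ (hL₁.trans (Finset.card_le_card
    (Finset.sdiff_subset_sdiff subset_rfl Finset.subset_union_left))) with h | h12
  · exact h
  rcases hasCompleteMinusMinor_or_inter_eq_five hconn h9 h₃ h₁ (hL₃.trans (Finset.card_le_card
    (Finset.sdiff_subset_sdiff subset_rfl Finset.subset_union_left))) with h | h31
  · exact h
  rcases hasCompleteMinusMinor_or_inter_eq_five hconn h9 h₃ h₂ (hL₃.trans (Finset.card_le_card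
    (Finset.sdiff_subset_sdiff subset_rfl Finset.subset_union_right))) with h | h32
  · exact h
  obtain ⟨c, hc⟩ := Finset.card_pos.1 hL₃
  simp only [Finset.mem_sdiff, Finset.mem_union, not_or] at hc
  obtain ⟨hc3, hc1, hc2⟩ := hc
  have herase : (L₃.erase c).card = 5 := by rw [Finset.card_erase_of_mem hc3, h₃.card_eq]
  -- Five elements of the six-element `L₃`, avoiding `c`, are all the others.
  have hsub : ∀ L : Finset V, c ∉ L → (L₃ ∩ L).card = 5 → L₃ ∩ L = L₃.erase c := fun L hcL hL =>
    Finset.eq_of_subset_of_card_le (fun v hv => Finset.mem_erase.2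
      ⟨fun h => hcL (h ▸ (Finset.mem_inter.1 hv).2), (Finset.mem_inter.1 hv).1⟩) (by omega)
  have hC : L₁ ∩ L₂ = L₃.erase c := by
    symm
    refine Finset.eq_of_subset_of_card_le (fun v hv => Finset.mem_inter.2 ⟨?_, ?_⟩) (by omega)
    · rw [← hsub L₁ hc1 h31] at hv
      exact (Finset.mem_inter.1 hv).2
    · rw [← hsub L₂ hc2 h32] at hv
      exact (Finset.mem_inter.1 hv).2
  obtain ⟨a, ha, haL⟩ := exists_eq_insert_of_inter_eq_five h₁.card_eq h12
  obtain ⟨b, hb, hbL⟩ := exists_eq_insert_of_inter_eq_five h₂.card_eq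
    (by rwa [Finset.inter_comm] at h12)
  rw [Finset.inter_comm] at hbL
  have ha1 : a ∈ L₁ := haL ▸ Finset.mem_insert_self _ _
  have hb2 : b ∈ L₂ := hbL ▸ Finset.mem_insert_self _ _
  refine hasCompleteMinusMinor_of_common_five hconn h9 (C := L₁ ∩ L₂) (a := a) (b := b) (c := c)
    h12 (fun h => ha (Finset.mem_inter.1 h).2) (fun h => hb (Finset.mem_inter.1 h).1)
    (fun h => hc1 (Finset.mem_inter.1 h).1) (fun h => ha (h ▸ hb2)) (fun h => hc1 (h ▸ ha1))
    (fun h => hc2 (h ▸ hb2)) (haL ▸ h₁.isClique) (hbL ▸ h₂.isClique) ?_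
  rw [hC, Finset.insert_erase hc3]
  exact h₃.isClique
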